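/- Let $S$ be an oriented surface with finitely many (at least one) punctures, and let $G\subset S$ be a finite connected graph that is a spine of $S$, so that $S$ is recovered, up to punctured discs, from the ribbon surface $N(G)$ (vertices thickened to discs, edges to bands). Let $f:G\to G$ be a Bestvina–Handel train track map, that is: (i) $f$ is induced by an orientation-preserving homeomorphism $F$ of $S$ carried by $N(G)$: $f$ sends vertices to vertices and edges to edge paths, is a homotopy equivalence, and comes from an orientation-preserving embedding of $N(G)$ in itself that maps vertex discs into vertex discs and edge bands along edge bands; (ii) for every $r\ge 1$ the restriction of $f^r$ to the interior of every edge is an immersion (each $f^r(e)$ is a nontrivial edge path without backtracking); (iii) the transition matrix $T$, whose entry $T_{i,j}$ is the number of times $f(e_j)$ passes over the edge $e_i$ in either direction, is irreducible. (In particular this covers the train track maps, with irreducible transition matrix, that the Bestvina–Handel algorithm produces for a pseudo-Anosov $F$.) Let $V(G)$ be the real vector space of weights on the edges of $G$ and $f_*:V(G)\to V(G)$ the linear map with matrix $T$. Two oriented edges starting at a vertex $v$ lie in the same gate at $v$ if for some $r>0$ their images under $f^r$ have a nontrivial common initial segment. Two different gates at $v$ are joined by an infinitesimal edge if there are oriented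 edges $e_1,e_2$ in these gates, an $r>0$ and an edge $e$ such that $f^r(e)$ contains $\bar e_1e_2$ or $\bar e_2e_1$ as a subpath. The train track $\tau$ has the gates as switches, and the edges of $G$ (real edges) and the infinitesimal edges as branches. Let $W(\tau)$ be the space of real weights on the branches of $\tau$ such that at each gate the sum of the weights of the ends of real edges equals the sum of the weights of the infinitesimal edges, and let $W(G,f)\subseteq V(G)$ be the image of $W(\tau)$ under restriction to the real edges. Then $f_*(W(G,f))\subseteq W(G,f)$, and the restriction $f_*|_{W(G,f)}:W(G,f)\to W(G,f)$ is a linear isomorphism. -/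

import Mathlib

/-- `CycBtw ρ a b c`: the points `a`, `b`, `c` are pairwise distinct, lie on one cycle of the
permutation `ρ`, and are met in this order when one runs along the cycle from `a`. -/
def CycBtw {X : Type*} (ρ : Equiv.Perm X) (a b c : X) : Prop :=
  ∃ i j : ℕ, 0 < i ∧ i < j ∧ (ρ ^ i) a = b ∧ (ρ ^ j) a = c ∧
    ∀ k : ℕ, 0 < k → k ≤ j → (ρ ^ k) a ≠ a

/-- An oriented edge (dart) of a graph with edge set `E`: the edge `e` with one of its two
orientations. -/
abbrev Dart (E : Type*) : Type _ := E × Bool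

/-- The same edge with the opposite orientation. -/
def Dart.rev {E : Type*} (d : Dart E) : Dart E := (d.1, !d.2)

/-- The reversed list of reversed darts. -/
def revPath {E : Type*} (p : List (Dart E)) : List (Dart E) := (p.map Dart.rev).reverse

/-- A finite connected graph `G` (loops and multiple edges allowed) embedded as a spine in an
oriented surface `S` with finitely many punctures, i.e. a ribbon graph: `src d` is the initial
vertex of the dart `d`, and `rot` sends a dart to the next dart, counterclockwise, with the same
initial vertex. The surface is recovered by replacing vertices with discs and edges with bands,
attached in the prescribed cyclic order so that the result `N(G)` is oriented, and gluing a
once-punctured disc to each boundary circle. -/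
structure RibbonGraph (V E : Type*) where
  src : Dart E → V
  rot : Equiv.Perm (Dart E)
  sameCycle_iff : ∀ d d' : Dart E, rot.SameCycle d d' ↔ src d = src d'
  connected : ∀ u v : V, Relation.ReflTransGen
    (fun x y => ∃ d : Dart E, src d = x ∧ src d.rev = y) u v

namespace RibbonGraph

variable {V E : Type*} (G : RibbonGraph V E)

/-- The terminal vertex of a dart. -/
def tgt (d : Dart E) : V := G.src d.rev

/-- `G.IsPath u p v`: the list of darts `p` is an edge path from `u` to `v`. -/
def IsPath : V → List (Dart E) → V → Prop
  | u, [], v => u = v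
  | u, d :: p, v => G.src d = u ∧ IsPath (G.tgt d) p v

theorem IsPath.append {G : RibbonGraph V E} {u v w : V} {p q : List (Dart E)}
    (hp : G.IsPath u p v) (hq : G.IsPath v q w) : G.IsPath u (p ++ q) w := by
  induction p generalizing u with
  | nil => cases hp; exact hq
  | cons d p ih => exact ⟨hp.1, ih hp.2⟩

end RibbonGraph

/-- A path without backtracking: no dart is immediately followed by its reverse. -/
def Reduced {E : Type*} (p : List (Dart E)) : Prop :=
  p.IsChain (fun d d' => d' ≠ d.rev)

/-- Homotopy of edge paths relative to the endpoints: the equivalence relation generated by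
deleting a backtrack `d d⁻¹`. -/
def PathHomotopic {E : Type*} : List (Dart E) → List (Dart E) → Prop :=
  Relation.EqvGen (fun p q => ∃ (a b : List (Dart E)) (d : Dart E),
    p = a ++ [d, d.rev] ++ b ∧ q = a ++ b)

/-- A map of the graph to itself that sends vertices to vertices and edges to (possibly trivial)
edge paths. -/
structure GraphMap {V E : Type*} (G : RibbonGraph V E) where
  vert : V → V
  edge : Dart E → List (Dart E)
  edge_isPath : ∀ d : Dart E, G.IsPath (vert (G.src d)) (edge d) (vert (G.tgt d))
  edge_rev : ∀ d : Dart E, edge d.rev = revPath (edge d)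

namespace GraphMap

variable {V E : Type*} {G : RibbonGraph V E}

/-- The image of an edge path (before any tightening). -/
def onPath (f : GraphMap G) (p : List (Dart E)) : List (Dart E) := p.flatMap f.edge

/-- The edge path `f^r(d)`. -/
def iter (f : GraphMap G) (r : ℕ) (d : Dart E) : List (Dart E) := f.onPath^[r] [d]

theorem onPath_isPath (f : GraphMap G) {u v : V} {p : List (Dart E)} (hp : G.IsPath u p v) :
    G.IsPath (f.vert u) (f.onPath p) (f.vert v) := by
  induction p generalizing u with
  | nil => cases hp; rfl
  | cons d p ih =>
    obtain ⟨rfl, h⟩ := hp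
    exact (f.edge_isPath d).append (ih h)

theorem onPath_revPath (f : GraphMap G) (p : List (Dart E)) :
    f.onPath (revPath p) = revPath (f.onPath p) := by
  induction p with
  | nil => rfl
  | cons d p ih =>
    simp only [onPath, revPath] at ih
    simp [onPath, revPath, List.flatMap_append, ih, f.edge_rev d]

/-- The composite `g ∘ f`. -/
def comp (g f : GraphMap G) : GraphMap G where
  vert := g.vert ∘ f.vert
  edge d := g.onPath (f.edge d)
  edge_isPath d := g.onPath_isPath (f.edge_isPath d)
  edge_rev d := by rw [f.edge_rev, g.onPath_revPath]

/-- `h` is homotopic to the identity of `G`; `γ v` is the track of the vertex `v`. -/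
def HomotopicToId (h : GraphMap G) : Prop :=
  ∃ γ : V → List (Dart E), (∀ v, G.IsPath v (γ v) (h.vert v)) ∧
    ∀ d, PathHomotopic (γ (G.src d) ++ h.edge d) (d :: γ (G.tgt d))

/-- `f` is a homotopy equivalence of the graph `G`. -/
def IsHomotopyEquiv (f : GraphMap G) : Prop :=
  ∃ h : GraphMap G, (h.comp f).HomotopicToId ∧ (f.comp h).HomotopicToId

/-! ### Carrying a surface homeomorphism -/

/-- The strand `(d, i)`: the place where the image of the dart `d` runs over the `i`-th dart of the
path `f(d)`. It is also regarded as a point on the boundary of the disc that thickens the initial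
vertex of that dart, namely the point where the thickened image leaves the disc. -/
@[ext] structure Strand (f : GraphMap G) where
  dart : Dart E
  idx : ℕ
  lt : idx < (f.edge dart).length

/-- The dart over which a strand runs. -/
def Strand.letter {f : GraphMap G} (s : f.Strand) : Dart E := (f.edge s.dart)[s.idx]'s.lt

/-- `s` and `t` are the same passage over an edge, read in opposite directions. -/
def Strand.IsReverse {f : GraphMap G} (s t : f.Strand) : Prop :=
  t.dart = s.dart.rev ∧ s.idx + t.idx + 1 = (f.edge s.dart).length

/-- Inside the disc at a vertex the strands `s` and `t` belong to the same connected piece of the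
image of `G`: either to the image of (the star of) one vertex, or to a single passage of the image
of an edge through the disc. -/
def Strand.SamePiece {f : GraphMap G} (s t : f.Strand) : Prop :=
  (s.idx = 0 ∧ t.idx = 0 ∧ G.src s.dart = G.src t.dart) ∨ s = t ∨
    (t.dart = s.dart.rev ∧ s.idx + t.idx = (f.edge s.dart).length)

/-- The counterclockwise cyclic order of the strands on the boundary of the disc at a vertex, when
the strands along each dart are lined up counterclockwise by `pos`. -/
def StrandCyc {f : GraphMap G} (pos : f.Strand → ℕ) (a b c : f.Strand) : Prop :=
  CycBtw G.rot a.letter b.letter c.letter ∨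
  (G.src a.letter = G.src b.letter ∧ G.src b.letter = G.src c.letter ∧
    ((a.letter = b.letter ∧ b.letter ≠ c.letter ∧ pos a < pos b) ∨
     (b.letter = c.letter ∧ c.letter ≠ a.letter ∧ pos b < pos c) ∨
     (c.letter = a.letter ∧ a.letter ≠ b.letter ∧ pos c < pos a) ∨
     (a.letter = b.letter ∧ b.letter = c.letter ∧
       ((pos a < pos b ∧ pos b < pos c) ∨ (pos b < pos c ∧ pos c < pos a) ∨
        (pos c < pos a ∧ pos a < pos b)))))

/-- The graph map `f` comes from an orientation preserving embedding of the ribbon surface `N(G)`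
(the fibered surface) in itself that sends vertex discs into vertex discs and edge bands along edge
bands: the strands of the image can be lined up over each edge so that distinct pieces of the image
are disjoint in each vertex disc and the cyclic order of the darts at each vertex is preserved. -/
def IsFiberedEmbedding (f : GraphMap G) : Prop :=
  ∃ pos : f.Strand → ℕ,
    (∀ s t, s.letter = t.letter → pos s = pos t → s = t) ∧
    (∀ s t s' t' : f.Strand, s.IsReverse s' → t.IsReverse t' → s.letter = t.letter →
      pos s < pos t → pos t' < pos s') ∧
    (∀ a b c d : f.Strand, a.SamePiece b → c.SamePiece d → ¬ a.SamePiece c →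
      ¬ (StrandCyc pos a c b ∧ StrandCyc pos b d a)) ∧
    (∀ a b c : f.Strand, a.idx = 0 → b.idx = 0 → c.idx = 0 →
      CycBtw G.rot a.dart b.dart c.dart → StrandCyc pos a b c)

/-- `f` is induced on the spine `G` by an orientation preserving homeomorphism of the punctured
surface `S` carried by the fibered surface `N(G)`. (An embedding of `N(G)` in itself extends, up to
isotopy, to a homeomorphism of `S` exactly when it is a homotopy equivalence.) -/
def InducedByHomeo (f : GraphMap G) : Prop := f.IsFiberedEmbedding ∧ f.IsHomotopyEquiv

/-! ### Train track maps -/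

/-- For every `r ≥ 1` the restriction of `f^r` to the interior of every edge is an immersion. -/
def IsTrainTrackMap (f : GraphMap G) : Prop :=
  (∀ d, f.edge d ≠ []) ∧ ∀ r, 1 ≤ r → ∀ d, Reduced (f.iter r d)

open scoped Classical in
/-- The transition matrix: the `(i, j)` entry is the number of times that `f(j)` passes over the
edge `i`, in either direction. -/
noncomputable def transitionMatrix (f : GraphMap G) : Matrix E E ℝ :=
  fun i j => (((f.edge (j, false)).map Prod.fst).count i : ℝ)

/-- A Bestvina–Handel train track map on the spine `G` of the punctured surface `S`. -/
structure IsBestvinaHandel (f : GraphMap G) : Prop where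
  inducedByHomeo : f.InducedByHomeo
  isTrainTrackMap : f.IsTrainTrackMap
  irreducible : f.transitionMatrix.IsIrreducible

open scoped Classical in
/-- The linear map `f_* : V(G) → V(G)` on the space of real weights on the edges of `G`. -/
noncomputable def pushforward [Fintype E] (f : GraphMap G) : (E → ℝ) →ₗ[ℝ] (E → ℝ) :=
  Matrix.toLin' f.transitionMatrix

/-! ### The train track `τ` and the space `W(G, f)` -/

/-- Two darts with the same initial vertex are in the same gate if some `f^r`, `r > 0`, sends them
to paths with a nontrivial common initial segment, i.e. with the same first dart. -/
def SameGate (f : GraphMap G) (d d' : Dart E) : Prop :=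
  G.src d = G.src d' ∧
    ∃ r > 0, ∃ x : Dart E, (f.iter r d).head? = some x ∧ (f.iter r d').head? = some x

/-- The gates, which are the switches of `τ`. (For a train track map `SameGate` is already an
equivalence relation, so that the quotient adds no further identifications.) -/
def Gate (f : GraphMap G) : Type _ := Quot f.SameGate

/-- The gate of a dart. -/
def gate (f : GraphMap G) (d : Dart E) : f.Gate := Quot.mk _ d

/-- Some `f^r(e)`, `r > 0`, passes through the turn `{d, d'}`, i.e. contains `d⁻¹ d'` or
`d'⁻¹ d` as a subpath. -/
def TakesTurn (f : GraphMap G) (d d' : Dart E) : Prop :=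
  ∃ r > 0, ∃ e : E, [d.rev, d'] <:+: f.iter r (e, false) ∨ [d'.rev, d] <:+: f.iter r (e, false)

/-- The infinitesimal edges of `τ`, as unordered pairs of distinct gates: the gates of `d` and `d'`
are joined if some `f^r(e)` passes through the turn `{d, d'}`. -/
def infEdges (f : GraphMap G) : Set (Sym2 f.Gate) :=
  {z | ∃ d d' : Dart E, z = s(f.gate d, f.gate d') ∧ f.gate d ≠ f.gate d' ∧ f.TakesTurn d d'}

/-- The branches of `τ`: the real edges and the infinitesimal edges. -/
abbrev Branch (f : GraphMap G) : Type _ := E ⊕ f.infEdges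

noncomputable instance [Finite E] (f : GraphMap G) : Fintype f.infEdges :=
  have : Finite f.Gate := Quot.finite _
  Fintype.ofFinite _

open scoped Classical in
/-- The switch condition at the gate `g` for weights `η` on the branches of `τ`: the total weight of
the ends of real edges at `g` (a real edge with both ends at `g` counts twice) equals the total
weight of the infinitesimal edges at `g`. -/
def SwitchCondition [Fintype E] (f : GraphMap G) (η : f.Branch → ℝ) (g : f.Gate) : Prop :=
  ∑ d : Dart E, (if f.gate d = g then η (Sum.inl d.1) else 0) =
    ∑ z : f.infEdges, (if g ∈ z.1 then η (Sum.inr z) else 0)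

/-- `W(τ)`: the (possibly negative) transverse measures on `τ`. -/
def transverseMeasures [Fintype E] (f : GraphMap G) : Submodule ℝ (f.Branch → ℝ) where
  carrier := {η | ∀ g, f.SwitchCondition η g}
  zero_mem' g := by simp [SwitchCondition]
  add_mem' {a b} ha hb g := by
    have h1 := ha g
    have h2 := hb g
    unfold SwitchCondition at *
    simp only [Pi.add_apply, ite_add_zero, Finset.sum_add_distrib, h1, h2]
  smul_mem' c a ha g := by
    have h1 := ha g
    unfold SwitchCondition at *
    simp only [Pi.smul_apply, smul_eq_mul, ← mul_ite_zero, ← Finset.mul_sum, h1]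

/-- `W(G, f) = π_*(W(τ))`: the weights on `G` that extend to a (possibly negative) transverse
measure on `τ`. -/
def weightSpace [Fintype E] (f : GraphMap G) : Submodule ℝ (E → ℝ) :=
  f.transverseMeasures.map (LinearMap.funLeft ℝ ℝ (Sum.inl : E → f.Branch))

end GraphMap

/-! Invariance is proved by duality. Call a function on gates alternating if its values at the two
ends of each infinitesimal edge add up to zero. By the Fredholm alternative for the switch
equations, `weightSpace` is the annihilator of the edge functions `endSum ψ` with `ψ` alternating
(`dotProduct_eq_zero_of_mem_weightSpace`, `mem_weightSpace`). The transpose of `T` sends `endSum ψ`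
to `endSum (ψ ∘ f.deriv)`, because the sum along `f(e)` telescopes at every turn
(`pullback_endSum`). Alternating functions are stable under composition with `f.deriv`, so the
annihilator is invariant.

For injectivity, reduce modulo 2, where the unsigned matrix `T` is the action of `f` on cellular
1-chains. On mod 2 cycles `T` is injective, since `f` is a homotopy equivalence. A chain killed by
`T` need not be a cycle, but its boundary is pushed to zero, and `f` is injective on periodic
vertices; so it is a cycle as soon as its boundary vanishes at the nonperiodic vertices.

Planarity supplies that condition. A nonperiodic vertex has at most two gates
(`atMostTwoGates_of_notMem_periodicPts`), for otherwise two disjoint tripods in a disc would end in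
the same three disjoint intervals. Giving the two gates the values 1 and -1 defines an integral
alternating function whose reduction modulo 2 is the boundary coefficient at the vertex. The integer
matrix formed by `T` and these extra rows is injective modulo 2, hence over the reals; the extra
rows vanish on `weightSpace`, so `T` is injective there. -/

open scoped Matrix

/-! ### Cyclic orders on the cycles of a permutation -/

section CyclicOrder

variable {X : Type*} [Finite X] {ρ : Equiv.Perm X} {a b c : X}

theorem exists_minimal_pow_apply_eq (ρ : Equiv.Perm X) (a : X) :
    ∃ n, 0 < n ∧ (ρ ^ n) a = a ∧ ∀ k, 0 < k → k < n → (ρ ^ k) a ≠ a := by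
  classical
  have h : ∃ n, 0 < n ∧ (ρ ^ n) a = a :=
    ⟨orderOf ρ, orderOf_pos ρ, by rw [pow_orderOf_eq_one]; rfl⟩
  exact ⟨Nat.find h, (Nat.find_spec h).1, (Nat.find_spec h).2,
    fun k hk hlt hka => Nat.find_min h hlt ⟨hk, hka⟩⟩

theorem CycBtw.ne_left {X : Type*} {ρ : Equiv.Perm X} {a b c : X} (h : CycBtw ρ a b c) : a ≠ b := by
  obtain ⟨i, j, hi, hij, rfl, -, h⟩ := h
  exact (h i hi hij.le).symm

theorem CycBtw.rotate (h : CycBtw ρ a b c) : CycBtw ρ b c a := by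
  obtain ⟨i, j, hi, hij, rfl, rfl, h⟩ := h
  obtain ⟨n, hn, hna, hmin⟩ := exists_minimal_pow_apply_eq ρ a
  have hjn : j < n := by
    by_contra hle
    exact h n hn (not_lt.mp hle) hna
  refine ⟨j - i, n - i, by omega, by omega, ?_, ?_, fun k hk hkn hka => ?_⟩
  · rw [← Equiv.Perm.mul_apply, ← pow_add]
    congr 2
    omega
  · rw [← Equiv.Perm.mul_apply, ← pow_add, Nat.sub_add_cancel (by omega), hna]
  · rw [← Equiv.Perm.mul_apply, ← pow_add, add_comm, pow_add, Equiv.Perm.mul_apply] at hka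
    exact hmin k hk (by omega) ((ρ ^ i).injective hka)

theorem CycBtw.ne_right (h : CycBtw ρ a b c) : c ≠ a := h.rotate.rotate.ne_left

theorem cycBtw_total (hb : ρ.SameCycle a b) (hc : ρ.SameCycle a c) (hab : a ≠ b) (hac : a ≠ c)
    (hbc : b ≠ c) : CycBtw ρ a b c ∨ CycBtw ρ c b a := by
  obtain ⟨n, hn, hna, hmin⟩ := exists_minimal_pow_apply_eq ρ a
  have key : ∀ x, ρ.SameCycle a x → a ≠ x → ∃ i, 0 < i ∧ i < n ∧ (ρ ^ i) a = x := by
    intro x hx hne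
    obtain ⟨i, rfl⟩ := hx.exists_nat_pow_eq
    have hmod : (ρ ^ (i % n)) a = (ρ ^ i) a := by
      conv_rhs => rw [← Nat.mod_add_div i n, pow_add, pow_mul, Equiv.Perm.mul_apply,
        Equiv.Perm.pow_apply_eq_self_of_apply_eq_self hna]
    refine ⟨i % n, Nat.pos_of_ne_zero fun h0 => hne ?_, Nat.mod_lt _ hn, hmod⟩
    rw [← hmod, h0]
    rfl
  obtain ⟨i, hi, hin, rfl⟩ := key b hb hab
  obtain ⟨j, hj, hjn, rfl⟩ := key c hc hac
  rcases lt_trichotomy i j with hij | rfl | hij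
  · exact Or.inl ⟨i, j, hi, hij, rfl, rfl, fun k hk hkj => hmin k hk (by omega)⟩
  · exact absurd rfl hbc
  · exact Or.inr (CycBtw.rotate ⟨j, i, hj, hij, rfl, rfl, fun k hk hkj => hmin k hk (by omega)⟩)

end CyclicOrder

/-! ### The derivative of `f` and its action on gates -/

namespace GraphMap

variable {V E : Type*} {G : RibbonGraph V E} {f : GraphMap G}

/-- The first dart of the image of a dart (the dart itself if the image is trivial). -/
def deriv (f : GraphMap G) (d : Dart E) : Dart E := (f.edge d).headD d

theorem head?_edge (hf : f.IsTrainTrackMap) (d : Dart E) :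
    (f.edge d).head? = some (f.deriv d) := by
  have h := hf.1 d
  unfold deriv
  cases hp : f.edge d with
  | nil => exact absurd hp h
  | cons x p => rfl

theorem src_deriv (hf : f.IsTrainTrackMap) (d : Dart E) :
    G.src (f.deriv d) = f.vert (G.src d) := by
  have h := f.edge_isPath d
  have h' := head?_edge hf d
  cases hp : f.edge d with
  | nil => exact absurd hp (hf.1 d)
  | cons x p =>
    rw [hp] at h h'
    obtain rfl : x = f.deriv d := by simpa using h'
    exact h.1

theorem src_iterate_deriv (hf : f.IsTrainTrackMap) (n : ℕ) (d : Dart E) :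
    G.src (f.deriv^[n] d) = f.vert^[n] (G.src d) := by
  induction n with
  | zero => rfl
  | succ n ih => rw [Function.iterate_succ_apply', Function.iterate_succ_apply', src_deriv hf, ih]

theorem iter_succ (f : GraphMap G) (r : ℕ) (d : Dart E) :
    f.iter (r + 1) d = f.onPath (f.iter r d) :=
  Function.iterate_succ_apply' _ _ _

theorem head?_iter (hf : f.IsTrainTrackMap) (r : ℕ) (d : Dart E) :
    (f.iter r d).head? = some (f.deriv^[r] d) := by
  induction r with
  | zero => rfl
  | succ r ih =>
    rw [iter_succ, Function.iterate_succ_apply']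
    cases hp : f.iter r d with
    | nil => simp [hp] at ih
    | cons x p =>
      obtain rfl : x = f.deriv^[r] d := by simpa [hp] using ih
      simp [onPath, head?_edge hf]

theorem sameGate_iff (hf : f.IsTrainTrackMap) {d d' : Dart E} :
    f.SameGate d d' ↔ G.src d = G.src d' ∧ ∃ r, f.deriv^[r] d = f.deriv^[r] d' := by
  refine and_congr_right fun _ => ⟨?_, ?_⟩
  · rintro ⟨r, -, x, h, h'⟩
    rw [head?_iter hf, Option.some_inj] at h h'
    exact ⟨r, h.trans h'.symm⟩
  · rintro ⟨r, h⟩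
    refine ⟨r + 1, r.succ_pos, _, head?_iter hf _ _, ?_⟩
    rw [head?_iter hf, Function.iterate_succ_apply', Function.iterate_succ_apply', h]

theorem sameGate_equivalence (hf : f.IsTrainTrackMap) : Equivalence f.SameGate where
  refl d := (sameGate_iff hf).2 ⟨rfl, 0, rfl⟩
  symm h := by
    obtain ⟨h, r, hr⟩ := (sameGate_iff hf).1 h
    exact (sameGate_iff hf).2 ⟨h.symm, r, hr.symm⟩
  trans {a b c} h h' := by
    obtain ⟨h, r, hr⟩ := (sameGate_iff hf).1 h
    obtain ⟨h', s, hs⟩ := (sameGate_iff hf).1 h'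
    refine (sameGate_iff hf).2 ⟨h.trans h', r + s, ?_⟩
    rw [add_comm, Function.iterate_add_apply, hr, ← Function.iterate_add_apply, add_comm,
      Function.iterate_add_apply, hs, ← Function.iterate_add_apply]

theorem gate_eq_iff (hf : f.IsTrainTrackMap) {d d' : Dart E} :
    f.gate d = f.gate d' ↔ f.SameGate d d' :=
  Quot.eq.trans (sameGate_equivalence hf).eqvGen_iff

theorem SameGate.deriv (hf : f.IsTrainTrackMap) {d d' : Dart E} (h : f.SameGate d d') :
    f.SameGate (f.deriv d) (f.deriv d') := by
  obtain ⟨h, r, hr⟩ := (sameGate_iff hf).1 h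
  refine (sameGate_iff hf).2 ⟨by rw [src_deriv hf, src_deriv hf, h], r, ?_⟩
  rw [← Function.iterate_succ_apply, ← Function.iterate_succ_apply,
    Function.iterate_succ_apply', Function.iterate_succ_apply', hr]

/-- Lying in one gate is an eventual condition, so `f.deriv` is injective on the gates at a vertex.
This carries a bound on the number of gates back from `f(v)` to `v`. -/
theorem SameGate.of_deriv (hf : f.IsTrainTrackMap) {d d' : Dart E} (hs : G.src d = G.src d')
    (h : f.SameGate (f.deriv d) (f.deriv d')) : f.SameGate d d' := by
  obtain ⟨-, r, hr⟩ := (sameGate_iff hf).1 h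
  exact (sameGate_iff hf).2 ⟨hs, r + 1, hr⟩

/-! ### Strands -/

/-- The first strand of a dart. -/
def firstStrand (hf : f.IsTrainTrackMap) (d : Dart E) : f.Strand :=
  ⟨d, 0, List.length_pos_iff.2 (hf.1 d)⟩

theorem letter_firstStrand (hf : f.IsTrainTrackMap) (d : Dart E) :
    (firstStrand hf d).letter = f.deriv d := by
  have h := head?_edge hf d
  rw [List.head?_eq_getElem?] at h
  exact (List.getElem?_eq_some_iff.1 h).2

section

variable {pos : f.Strand → ℕ} {a b c : f.Strand}

theorem StrandCyc.rotate [Finite E] (h : StrandCyc pos a b c) : StrandCyc pos b c a := by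
  rcases h with h | ⟨h, h', h''⟩
  · exact Or.inl h.rotate
  · refine Or.inr ⟨h', (h.trans h').symm, ?_⟩
    rcases h'' with h | h | h | ⟨h₁, h₂, h₃⟩
    · exact Or.inr (Or.inr (Or.inl h))
    · exact Or.inl h
    · exact Or.inr (Or.inl h)
    · refine Or.inr (Or.inr (Or.inr ⟨h₂, (h₁.trans h₂).symm, ?_⟩))
      tauto

theorem strandCyc_total [Finite E]
    (hpos : ∀ s t : f.Strand, s.letter = t.letter → pos s = pos t → s = t)
    (hab : G.src a.letter = G.src b.letter) (hac : G.src a.letter = G.src c.letter)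
    (h₁ : a.letter ≠ b.letter) (h₂ : c.letter ≠ b.letter) (h : a ≠ c) :
    StrandCyc pos a b c ∨ StrandCyc pos c b a := by
  by_cases h₃ : a.letter = c.letter
  · rcases lt_trichotomy (pos a) (pos c) with hlt | heq | hlt
    · exact Or.inr (Or.inr ⟨hac.symm.trans hab, hab.symm, Or.inr (Or.inr (Or.inl ⟨h₃, h₂, hlt⟩))⟩)
    · exact absurd (hpos a c h₃ heq) h
    · exact Or.inl (Or.inr ⟨hab, hab.symm.trans hac,
        Or.inr (Or.inr (Or.inl ⟨h₃.symm, h₁, hlt⟩))⟩)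
  · exact (cycBtw_total ((G.sameCycle_iff _ _).2 hab) ((G.sameCycle_iff _ _).2 hac) h₁ h₃
      h₂.symm).imp Or.inl Or.inl

/-- Running counterclockwise from `a`, one leaves the common dart to meet `b` and re-enters it
before reaching `c`, so `c` comes first on that dart. -/
theorem StrandCyc.pos_lt [Finite E] (h : StrandCyc pos a b c) (hab : a.letter ≠ b.letter)
    (hac : a.letter = c.letter) : pos c < pos a := by
  rcases h with h | ⟨-, -, h | h | h | h⟩
  · exact absurd hac.symm h.ne_right
  · exact absurd h.1 hab
  · exact absurd (hac.trans h.1.symm) hab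
  · exact h.2.2
  · exact absurd h.1 hab

theorem StrandCyc.cycBtw (h : StrandCyc pos a b c) (hab : a.letter ≠ b.letter)
    (hbc : b.letter ≠ c.letter) (hac : a.letter ≠ c.letter) :
    CycBtw G.rot a.letter b.letter c.letter := by
  rcases h with h | ⟨-, -, h | h | h | h⟩
  · exact h
  · exact absurd h.1 hab
  · exact absurd h.1 hbc
  · exact absurd h.1.symm hac
  · exact absurd h.1 hab

end

/-- Each gate is an interval in the cyclic order of the strands at a vertex. -/
theorem not_strandCyc_of_iterate_deriv_eq [Finite E] (hf : f.IsTrainTrackMap) {pos : f.Strand → ℕ}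
    (hord : ∀ a b c : f.Strand, a.idx = 0 → b.idx = 0 → c.idx = 0 →
      CycBtw G.rot a.dart b.dart c.dart → StrandCyc pos a b c) (r : ℕ) {s t p q : f.Strand}
    (hst : G.src s.letter = G.src t.letter) (hsp : G.src s.letter = G.src p.letter)
    (hsq : G.src s.letter = G.src q.letter)
    (hr : f.deriv^[r] s.letter = f.deriv^[r] t.letter)
    (hp : ¬ f.SameGate s.letter p.letter) (hq : ¬ f.SameGate s.letter q.letter)
    (h₁ : StrandCyc pos s p t) (h₂ : StrandCyc pos t q s) : False := by
  have hg : f.SameGate s.letter t.letter := (sameGate_iff hf).2 ⟨hst, r, hr⟩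
  have he := sameGate_equivalence hf
  have hne : ∀ x y : Dart E, ¬ f.SameGate x y → x ≠ y := by
    rintro x _ h rfl
    exact h (he.refl x)
  have hp' : ¬ f.SameGate t.letter p.letter := fun h => hp (he.trans hg h)
  have hq' : ¬ f.SameGate t.letter q.letter := fun h => hq (he.trans hg h)
  by_cases heq : s.letter = t.letter
  · exact lt_asymm (h₁.pos_lt (hne _ _ hp) heq) (h₂.pos_lt (hne _ _ hq') heq.symm)
  -- While the two darts of the gate stay distinct, `f.deriv` preserves the cyclic order with `p`
  -- and `q`. Once they merge, the two orders give opposite inequalities between positions.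
  induction r generalizing s t p q with
  | zero => exact heq hr
  | succ r ih =>
    have c₁ := h₁.cycBtw (hne _ _ hp) (hne _ _ hp').symm heq
    have c₂ := h₂.cycBtw (hne _ _ hq') (hne _ _ hq).symm (Ne.symm heq)
    have d₁ := hord (firstStrand hf s.letter) (firstStrand hf p.letter) (firstStrand hf t.letter)
      rfl rfl rfl c₁
    have d₂ := hord (firstStrand hf t.letter) (firstStrand hf q.letter) (firstStrand hf s.letter)
      rfl rfl rfl c₂
    have nd : ∀ {x y : Dart E}, G.src x = G.src y → ¬ f.SameGate x y →
        ¬ f.SameGate (f.deriv x) (f.deriv y) := fun hs h h' => h (h'.of_deriv hf hs)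
    have ep := nd hsp hp
    have eq := nd hsq hq
    have ep' := nd (hst.symm.trans hsp) hp'
    have eq' := nd (hst.symm.trans hsq) hq'
    rw [← letter_firstStrand hf, ← letter_firstStrand hf] at ep eq ep' eq'
    by_cases heq' : f.deriv s.letter = f.deriv t.letter
    · rw [← letter_firstStrand hf, ← letter_firstStrand hf] at heq'
      exact lt_asymm (d₁.pos_lt (hne _ _ ep) heq') (d₂.pos_lt (hne _ _ eq') heq'.symm)
    · rw [← letter_firstStrand hf, ← letter_firstStrand hf] at heq'
      refine ih ?_ ?_ ?_ ?_ ep eq d₁ d₂ ?_ ep' eq' heq'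
      · simp only [letter_firstStrand, src_deriv hf, hst]
      · simp only [letter_firstStrand, src_deriv hf, hsp]
      · simp only [letter_firstStrand, src_deriv hf, hsq]
      · simp only [letter_firstStrand]
        exact hr
      · simp only [letter_firstStrand]
        exact hg.deriv hf

/-! ### Counting gates at nonperiodic vertices -/

/-- `f` has at most two gates at the vertex `v`. -/
def AtMostTwoGates (f : GraphMap G) (v : V) : Prop :=
  ∀ y : Fin 3 → Dart E, (∀ i, G.src (y i) = v) → ∃ i j, i ≠ j ∧ f.SameGate (y i) (y j)

/-- Every gate at the image of a periodic vertex `w` is hit by a gate at `w`. -/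
theorem exists_sameGate_deriv [Finite E] (hf : f.IsTrainTrackMap) {w : V}
    (hw : w ∈ Function.periodicPts f.vert) {z : Dart E} (hz : G.src z = f.vert w) :
    ∃ x, G.src x = w ∧ f.SameGate z (f.deriv x) := by
  obtain ⟨p, hp, hpw⟩ := hw
  -- The orbit of `z` repeats along multiples of the period `p`. With `m + 1 = (j - i) * p`, the
  -- dart `f.deriv^[m] z` starts at `w`, and its derivative merges with `z` after `i * p` steps.
  obtain ⟨i, j, hij, he⟩ : ∃ i j : ℕ, i < j ∧ f.deriv^[i * p] z = f.deriv^[j * p] z := by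
    obtain ⟨i, j, hij, he⟩ := Finite.exists_ne_map_eq_of_infinite fun k : ℕ => f.deriv^[k * p] z
    rcases lt_or_gt_of_ne hij with h | h
    exacts [⟨i, j, h, he⟩, ⟨j, i, h, he.symm⟩]
  obtain ⟨k, rfl⟩ := Nat.exists_eq_add_of_lt hij
  have hm : 0 < (k + 1) * p := by positivity
  obtain ⟨m, hm'⟩ := Nat.exists_eq_add_of_lt hm
  rw [zero_add] at hm'
  have hper : f.vert^[m + 1] w = w := by
    rw [← hm', mul_comm]
    exact hpw.mul_const (k + 1)
  refine ⟨f.deriv^[m] z, ?_, (sameGate_iff hf).2 ⟨?_, i * p, ?_⟩⟩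
  · rw [src_iterate_deriv hf, hz, ← Function.iterate_succ_apply, hper]
  · rw [src_deriv hf, src_iterate_deriv hf, hz, ← Function.iterate_succ_apply, hper]
  · rw [he, ← Function.iterate_succ_apply' f.deriv, ← Function.iterate_add_apply,
      Nat.succ_eq_add_one, ← hm']
    congr 2
    ring

/-- Three gates at `u` map to three distinct gates at `f(w)`, each of which also contains the image
of a dart at `w`. The images of the stars of `u` and `w` are disjoint pieces of the disc, yet each
would reach the same three disjoint intervals of the boundary. -/
theorem atMostTwoGates_of_vert_eq [Finite E] (hf : f.IsTrainTrackMap) (he : f.IsFiberedEmbedding)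
    {u w : V} (hw : w ∈ Function.periodicPts f.vert) (huw : u ≠ w) (h : f.vert u = f.vert w) :
    f.AtMostTwoGates u := by
  obtain ⟨pos, hpos, -, hcross, hord⟩ := he
  intro y hy
  by_contra! hcon
  have hsy : ∀ i, G.src (f.deriv (y i)) = f.vert w := fun i => by rw [src_deriv hf, hy, h]
  choose x hx hxy using fun i => exists_sameGate_deriv hf hw (hsy i)
  have eqv := sameGate_equivalence hf
  have hny : ∀ i j, i ≠ j → ¬ f.SameGate (f.deriv (y i)) (f.deriv (y j)) := fun i j hij h' =>
    hcon i j hij (h'.of_deriv hf (by rw [hy, hy]))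
  have hnx : ∀ i j, i ≠ j → ¬ f.SameGate (f.deriv (x i)) (f.deriv (x j)) := fun i j hij h' =>
    hny i j hij (eqv.trans (hxy i) (eqv.trans h' (eqv.symm (hxy j))))
  have hnyx : ∀ i j, i ≠ j → ¬ f.SameGate (f.deriv (y i)) (f.deriv (x j)) := fun i j hij h' =>
    hny i j hij (eqv.trans h' (eqv.symm (hxy j)))
  have hne : ∀ a b : Dart E, ¬ f.SameGate a b → a ≠ b := by
    rintro a _ h rfl
    exact h (eqv.refl a)
  have hsx : ∀ i, G.src (f.deriv (x i)) = f.vert w := fun i => by rw [src_deriv hf, hx]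
  let X : Fin 3 → f.Strand := fun i => firstStrand hf (x i)
  let Y : Fin 3 → f.Strand := fun i => firstStrand hf (y i)
  have hX : ∀ i, (X i).letter = f.deriv (x i) := fun i => letter_firstStrand hf _
  have hY : ∀ i, (Y i).letter = f.deriv (y i) := fun i => letter_firstStrand hf _
  have tot : ∀ i j, i ≠ j → StrandCyc pos (X i) (X j) (Y i) ∨ StrandCyc pos (Y i) (X j) (X i) := by
    intro i j hij
    refine strandCyc_total hpos ?_ ?_ ?_ ?_ ?_
    · rw [hX, hX, hsx, hsx]
    · rw [hX, hY, hsx, hsy]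
    · rw [hX, hX]
      exact hne _ _ (hnx i j hij)
    · rw [hX, hY]
      exact hne _ _ (hnyx i j hij)
    · intro heq
      have : x i = y i := congrArg Strand.dart heq
      exact huw (by rw [← hx i, ← hy i, this])
  -- Gate `i` is an interval, so the other gates all lie on the same one of the two arcs between `X
  -- i` and `Y i`.
  have int : ∀ i j k, i ≠ j → i ≠ k → StrandCyc pos (X i) (X j) (Y i) →
      ¬ StrandCyc pos (Y i) (X k) (X i) := by
    intro i j k hij hik h₁ h₂
    obtain ⟨-, r, hr⟩ := (sameGate_iff hf).1 (hxy i)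
    refine not_strandCyc_of_iterate_deriv_eq hf hord r ?_ ?_ ?_ ?_ ?_ ?_ h₁ h₂
    · rw [hX, hY, hsx, hsy]
    · rw [hX, hX, hsx, hsx]
    · rw [hX, hX, hsx, hsx]
    · rw [hX, hY, hr]
    · rw [hX, hX]
      exact hnx i j hij
    · rw [hX, hX]
      exact hnx i k hik
  have same : ∀ i j, (X i).SamePiece (X j) ∧ (Y i).SamePiece (Y j) := fun i j =>
    ⟨Or.inl ⟨rfl, rfl, (hx i).trans (hx j).symm⟩, Or.inl ⟨rfl, rfl, (hy i).trans (hy j).symm⟩⟩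
  have notSame : ∀ i j, ¬ (X i).SamePiece (Y j) := by
    rintro i j (⟨-, -, hs⟩ | hs | ⟨-, hs⟩)
    · exact huw ((hy j).symm.trans (hs.symm.trans (hx i)))
    · have : x i = y j := congrArg Strand.dart hs
      exact huw (by rw [← hx i, ← hy j, this])
    · exact absurd hs (X i).lt.ne
  have side : ∀ i, (∀ j, i ≠ j → StrandCyc pos (X i) (X j) (Y i)) ∨
      ∀ j, i ≠ j → StrandCyc pos (Y i) (X j) (X i) := by
    intro i
    by_cases h' : ∃ j, i ≠ j ∧ StrandCyc pos (Y i) (X j) (X i)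
    · obtain ⟨j, hij, hj⟩ := h'
      exact Or.inr fun k hk => (tot i k hk).resolve_left fun h'' => int i k j hk hij h'' hj
    · exact Or.inl fun j hij => (tot i j hij).resolve_right fun h'' => h' ⟨j, hij, h''⟩
  have left : ∀ i j, i ≠ j → (∀ k, i ≠ k → StrandCyc pos (X i) (X k) (Y i)) →
      ¬ ∀ k, j ≠ k → StrandCyc pos (X j) (X k) (Y j) := fun i j hij h₁ h₂ =>
    hcross (X i) (X j) (Y j) (Y i) (same i j).1 (same j i).2 (notSame i j)
      ⟨(h₂ i hij.symm).rotate, (h₁ j hij).rotate⟩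
  have right : ∀ i j, i ≠ j → (∀ k, i ≠ k → StrandCyc pos (Y i) (X k) (X i)) →
      ¬ ∀ k, j ≠ k → StrandCyc pos (Y j) (X k) (X j) := fun i j hij h₁ h₂ =>
    hcross (X i) (X j) (Y i) (Y j) (same i j).1 (same i j).2 (notSame i i)
      ⟨(h₁ j hij).rotate.rotate, (h₂ i hij.symm).rotate.rotate⟩
  -- Each gate has one of two orders of `X i` and `Y i`. Two of the three gates share an order, and
  -- for these the chord from `X i` to `X j` crosses that from `Y i` to `Y j`.
  rcases side 0 with h₀ | h₀ <;> rcases side 1 with h₁ | h₁ <;> rcases side 2 with h₂ | h₂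
  · exact left 0 1 (by decide) h₀ h₁
  · exact left 0 1 (by decide) h₀ h₁
  · exact left 0 2 (by decide) h₀ h₂
  · exact right 1 2 (by decide) h₁ h₂
  · exact left 1 2 (by decide) h₁ h₂
  · exact right 0 2 (by decide) h₀ h₂
  · exact right 0 1 (by decide) h₀ h₁
  · exact right 0 1 (by decide) h₀ h₁

/-- A vertex with three or more gates is periodic. -/
theorem atMostTwoGates_of_notMem_periodicPts [Finite V] [Finite E] (hf : f.IsTrainTrackMap)
    (he : f.IsFiberedEmbedding) {v : V} (hv : v ∉ Function.periodicPts f.vert) :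
    f.AtMostTwoGates v := by
  -- At the last nonperiodic vertex of the orbit, the image also has a periodic preimage, so the
  -- tripod argument applies. Earlier vertices follow by injectivity of `f.deriv` on gates.
  have key : ∀ n v, f.vert^[n] v ∈ Function.periodicPts f.vert →
      v ∉ Function.periodicPts f.vert → f.AtMostTwoGates v := by
    intro n
    induction n with
    | zero => exact fun v h h' => absurd h h'
    | succ n ih =>
      intro v h hv
      by_cases hfv : f.vert v ∈ Function.periodicPts f.vert
      · obtain ⟨p, hp, hpv⟩ := hfv
        obtain ⟨m, rfl⟩ := Nat.exists_eq_add_of_lt hp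
        rw [zero_add] at hpv
        have hvw : f.vert (f.vert^[m] (f.vert v)) = f.vert v := by
          rw [← Function.iterate_succ_apply' f.vert]
          exact hpv
        have hw : f.vert^[m] (f.vert v) ∈ Function.periodicPts f.vert :=
          ⟨m + 1, m.succ_pos, hpv.apply_iterate m⟩
        exact atMostTwoGates_of_vert_eq hf he hw (fun h' => hv (h' ▸ hw)) hvw.symm
      · intro y hy
        obtain ⟨i, j, hij, h'⟩ := ih (f.vert v) h hfv (f.deriv ∘ y) fun i => by
          rw [Function.comp_apply, src_deriv hf, hy]
        exact ⟨i, j, hij, h'.of_deriv hf (by rw [hy, hy])⟩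
  obtain ⟨i, j, hij, h⟩ := Finite.exists_ne_map_eq_of_infinite fun k : ℕ => f.vert^[k] v
  wlog hlt : i < j generalizing i j
  · exact this j i hij.symm h.symm (lt_of_le_of_ne (not_lt.mp hlt) hij.symm)
  refine key i v ⟨j - i, Nat.sub_pos_of_lt hlt, ?_⟩ hv
  rw [Function.IsPeriodicPt, Function.IsFixedPt, ← Function.iterate_add_apply,
    Nat.sub_add_cancel hlt.le]
  exact h.symm

end GraphMap

/-! ### From injectivity modulo 2 to injectivity over the reals -/

/-- An integer matrix that is injective modulo `2` is injective over the reals. -/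
theorem Matrix.mulVec_eq_zero_of_injective_zmod_two {ι κ : Type*} [Fintype ι] [Fintype κ]
    (M : Matrix ι κ ℤ)
    (h : ∀ x : κ → ZMod 2, M.map (Int.castRingHom (ZMod 2)) *ᵥ x = 0 → x = 0) {y : κ → ℝ}
    (hy : M.map (Int.castRingHom ℝ) *ᵥ y = 0) : y = 0 := by
  classical
  -- A left inverse modulo 2 lifts entrywise to an integer matrix `N`; then `N * M` has odd, hence
  -- nonzero, determinant.
  obtain ⟨g, hg⟩ := LinearMap.exists_leftInverse_of_injective
    (Matrix.toLin' (M.map (Int.castRingHom (ZMod 2)))) (LinearMap.ker_eq_bot'.2 h)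
  have hN : LinearMap.toMatrix' g * M.map (Int.castRingHom (ZMod 2)) = 1 := by
    rw [← LinearMap.toMatrix'_toLin' (M.map (Int.castRingHom (ZMod 2))),
      ← LinearMap.toMatrix'_comp, hg, LinearMap.toMatrix'_id]
  let N : Matrix κ ι ℤ := fun i j => (ZMod.intCast_surjective (LinearMap.toMatrix' g i j)).choose
  have hN' : N.map (Int.castRingHom (ZMod 2)) = LinearMap.toMatrix' g := by
    ext i j
    exact (ZMod.intCast_surjective (LinearMap.toMatrix' g i j)).choose_spec
  have hdet : (N * M).det ≠ 0 := by
    intro h0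
    have h1 : Int.castRingHom (ZMod 2) (N * M).det = 1 := by
      rw [RingHom.map_det, RingHom.mapMatrix_apply, Matrix.map_mul, hN', hN, Matrix.det_one]
    rw [h0, map_zero] at h1
    exact zero_ne_one h1
  refine Matrix.eq_zero_of_mulVec_eq_zero (M := (N * M).map (Int.castRingHom ℝ)) ?_ ?_
  · rw [← RingHom.mapMatrix_apply, ← RingHom.map_det]
    simpa using hdet
  · rw [Matrix.map_mul, ← Matrix.mulVec_mulVec, hy, Matrix.mulVec_zero]

/-! ### Edge weights along paths -/

theorem Dart.rev_rev {E : Type*} (d : Dart E) : d.rev.rev = d := by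
  simp [Dart.rev]

theorem RibbonGraph.IsPath.tgt_eq_src {V E : Type*} {G : RibbonGraph V E} {p q : List (Dart E)}
    {a b : Dart E} {u v : V} (h : G.IsPath u (p ++ a :: b :: q) v) : G.tgt a = G.src b := by
  induction p generalizing u with
  | nil => exact h.2.1.symm
  | cons d p ih => exact ih h.2

/-- The total value of the edge weight `ξ` along an edge path. -/
def pathSum {E R : Type*} [AddCommMonoid R] (ξ : E → R) (p : List (Dart E)) : R :=
  (p.map fun d => ξ d.1).sum

section PathSum

variable {E R : Type*} [AddCommMonoid R] (ξ : E → R)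

theorem pathSum_append (p q : List (Dart E)) :
    pathSum ξ (p ++ q) = pathSum ξ p + pathSum ξ q := by
  simp [pathSum]

theorem pathSum_cons (d : Dart E) (p : List (Dart E)) :
    pathSum ξ (d :: p) = ξ d.1 + pathSum ξ p := by
  simp [pathSum]

theorem pathSum_revPath (p : List (Dart E)) : pathSum ξ (revPath p) = pathSum ξ p := by
  simp [pathSum, revPath, Dart.rev, List.sum_reverse, Function.comp_def]

/-- A backtrack contributes its weight twice, which is zero in characteristic 2. -/
theorem PathHomotopic.pathSum_eq {E R : Type*} [CommRing R] [CharP R 2] {p q : List (Dart E)}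
    (h : PathHomotopic p q) (ξ : E → R) : pathSum ξ p = pathSum ξ q := by
  induction h with
  | rel p q h =>
    obtain ⟨a, b, d, rfl, rfl⟩ := h
    simp [pathSum, Dart.rev, ← add_assoc, CharTwo.add_self_eq_zero]
  | refl p => rfl
  | symm p q _ ih => exact ih.symm
  | trans p q r _ _ ih ih' => exact ih.trans ih'

end PathSum

/-- The total weight at the two ends of an edge. -/
def endSum {E R : Type*} [Add R] (ψ : Dart E → R) (e : E) : R := ψ (e, false) + ψ (e, true)

theorem endSum_fst {E R : Type*} [AddCommMonoid R] (ψ : Dart E → R) (d : Dart E) :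
    endSum ψ d.1 = ψ d + ψ d.rev := by
  obtain ⟨e, _ | _⟩ := d
  · rfl
  · exact add_comm _ _

theorem dotProduct_endSum {E R : Type*} [Fintype E] [CommRing R] (x : E → R) (ψ : Dart E → R) :
    x ⬝ᵥ endSum ψ = ∑ d : Dart E, x d.1 * ψ d := by
  rw [Fintype.sum_prod_type]
  simp [dotProduct, endSum, mul_add, add_comm]

/-- In characteristic 2 this is the duality of boundary and coboundary: `endSum` of a vertex
function is its coboundary, and the terms on the right pair `c` with the boundary of `x`. -/
theorem endSum_comp_dotProduct {E V R : Type*} [Fintype E] [Fintype V] [DecidableEq V]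
    [CommRing R] (x : E → R) (c : V → R) (s : Dart E → V) :
    x ⬝ᵥ endSum (fun d => c (s d)) =
      ∑ v, c v * x ⬝ᵥ endSum (fun d => if s d = v then (1 : R) else 0) := by
  simp only [dotProduct_endSum, Finset.mul_sum]
  rw [Finset.sum_comm]
  refine Finset.sum_congr rfl fun d _ => ?_
  simp [mul_comm]

namespace GraphMap

variable {V E : Type*} {G : RibbonGraph V E} {f : GraphMap G}

/-! ### The transpose of the transition matrix -/

section Pullback

variable {R : Type*} [CommRing R]

/-- The pullback of an edge weight: the transpose of the transition matrix. -/
def pullback (f : GraphMap G) (ξ : E → R) (e : E) : R := pathSum ξ (f.edge (e, false))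

theorem pathSum_edge (f : GraphMap G) (ξ : E → R) (d : Dart E) :
    pathSum ξ (f.edge d) = f.pullback ξ d.1 := by
  obtain ⟨e, _ | _⟩ := d
  · rfl
  · rw [show (e, true) = Dart.rev (e, false) from rfl, f.edge_rev, pathSum_revPath]
    rfl

theorem pathSum_onPath (f : GraphMap G) (ξ : E → R) (p : List (Dart E)) :
    pathSum ξ (f.onPath p) = pathSum (f.pullback ξ) p := by
  induction p with
  | nil => rfl
  | cons d p ih =>
    rw [pathSum_cons, ← ih, ← pathSum_edge, ← pathSum_append]
    rfl

open scoped Classical in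
/-- The transition matrix with entries in a ring. -/
noncomputable def transitionMatrixOver (f : GraphMap G) (R : Type*) [CommRing R] : Matrix E E R :=
  fun i j => (((f.edge (j, false)).map Prod.fst).count i : R)

theorem vecMul_transitionMatrixOver [Fintype E] (f : GraphMap G) (ξ : E → R) :
    Matrix.vecMul ξ (f.transitionMatrixOver R) = f.pullback ξ := by
  classical
  ext j
  have h := Finset.sum_list_map_count ((f.edge (j, false)).map Prod.fst) ξ
  rw [List.map_map] at h
  refine Eq.trans ?_ h.symm
  rw [Finset.sum_subset (Finset.subset_univ _)]
  · refine Finset.sum_congr rfl fun i _ => ?_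
    rw [nsmul_eq_mul, mul_comm]
    unfold transitionMatrixOver
    congr!
  · intro i _ hi
    rw [List.count_eq_zero.2 (by simpa using hi), zero_smul]

theorem transitionMatrixOver_mulVec_dotProduct [Fintype E] (f : GraphMap G) (x ξ : E → R) :
    (f.transitionMatrixOver R *ᵥ x) ⬝ᵥ ξ = x ⬝ᵥ f.pullback ξ := by
  rw [dotProduct_comm, Matrix.dotProduct_mulVec, vecMul_transitionMatrixOver, dotProduct_comm]

theorem transitionMatrixOver_map {S : Type*} [CommRing S] (f : GraphMap G) (φ : R →+* S) :
    (f.transitionMatrixOver R).map φ = f.transitionMatrixOver S := by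
  ext i j
  simp [transitionMatrixOver]

end Pullback

/-- A map homotopic to the identity acts trivially on mod 2 cohomology; the correcting coboundary
comes from the weights of the vertex tracks. -/
theorem pullback_of_homotopicToId {R : Type*} [CommRing R] [CharP R 2] {h : GraphMap G}
    (hh : (h.comp f).HomotopicToId) (ξ : E → R) :
    ∃ c : V → R, f.pullback (h.pullback ξ) = ξ + endSum fun d => c (G.src d) := by
  obtain ⟨γ, -, hγ⟩ := hh
  refine ⟨fun v => pathSum ξ (γ v), ?_⟩
  ext e
  have h₁ := (hγ (e, false)).pathSum_eq ξ
  rw [pathSum_append, pathSum_cons] at h₁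
  have h₂ : f.pullback (h.pullback ξ) e = pathSum ξ ((h.comp f).edge (e, false)) :=
    (pathSum_onPath h ξ _).symm
  have h₃ : endSum (fun d => pathSum ξ (γ (G.src d))) e =
      pathSum ξ (γ (G.src (e, false))) + pathSum ξ (γ (G.tgt (e, false))) := rfl
  rw [h₂, Pi.add_apply, h₃, ← sub_eq_zero]
  have h₄ := CharTwo.add_self_eq_zero (pathSum ξ (γ (G.src (e, false))))
  linear_combination h₁ - h₄

/-! ### Turns -/

theorem infix_onPath (hf : f.IsTrainTrackMap) {d d' : Dart E} {p : List (Dart E)}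
    (h : [d.rev, d'] <:+: p) : [(f.deriv d).rev, f.deriv d'] <:+: f.onPath p := by
  obtain ⟨a, b, rfl⟩ := h
  have h₁ := head?_edge hf d
  have h₂ := head?_edge hf d'
  cases hp : f.edge d with
  | nil => exact absurd hp (hf.1 d)
  | cons x p =>
    cases hq : f.edge d' with
    | nil => exact absurd hq (hf.1 d')
    | cons y q =>
      rw [hp, List.head?_cons, Option.some_inj] at h₁
      rw [hq, List.head?_cons, Option.some_inj] at h₂
      rw [← h₁, ← h₂]
      refine ⟨f.onPath a ++ revPath p, q ++ f.onPath b, ?_⟩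
      simp [onPath, f.edge_rev, hp, hq, revPath]

theorem TakesTurn.deriv (hf : f.IsTrainTrackMap) {d d' : Dart E} (h : f.TakesTurn d d') :
    f.TakesTurn (f.deriv d) (f.deriv d') := by
  obtain ⟨r, hr, e, h⟩ := h
  refine ⟨r + 1, r.succ_pos, e, ?_⟩
  rw [iter_succ]
  exact h.imp (infix_onPath hf) (infix_onPath hf)

theorem TakesTurn.iterate_deriv (hf : f.IsTrainTrackMap) {d d' : Dart E} (h : f.TakesTurn d d')
    (n : ℕ) : f.TakesTurn (f.deriv^[n] d) (f.deriv^[n] d') := by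
  induction n with
  | zero => exact h
  | succ n ih =>
    rw [Function.iterate_succ_apply', Function.iterate_succ_apply']
    exact ih.deriv hf

theorem not_takesTurn_self (hf : f.IsTrainTrackMap) (d : Dart E) : ¬ f.TakesTurn d d := by
  rintro ⟨r, hr, e, h⟩
  rw [or_self] at h
  have h' := List.IsChain.infix (hf.2 r hr (e, false)) h
  simp [Dart.rev_rev] at h'

/-- If the two darts merged under an iterate, the image of the turn would be a backtrack in some
`f^r(e)`, contrary to the train track condition. -/
theorem TakesTurn.not_sameGate (hf : f.IsTrainTrackMap) {d d' : Dart E} (h : f.TakesTurn d d') :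
    ¬ f.SameGate d d' := by
  intro hs
  obtain ⟨-, r, hr⟩ := (sameGate_iff hf).1 hs
  have h' := h.iterate_deriv hf r
  rw [hr] at h'
  exact not_takesTurn_self hf _ h'

theorem exists_isPath_iter (f : GraphMap G) (r : ℕ) (d : Dart E) :
    ∃ u v, G.IsPath u (f.iter r d) v := by
  induction r with
  | zero => exact ⟨G.src d, G.tgt d, rfl, rfl⟩
  | succ r ih =>
    obtain ⟨u, v, h⟩ := ih
    rw [iter_succ]
    exact ⟨_, _, f.onPath_isPath h⟩

theorem TakesTurn.src_eq {d d' : Dart E} (h : f.TakesTurn d d') : G.src d = G.src d' := by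
  have key : ∀ {r e} {d d' : Dart E}, [d.rev, d'] <:+: f.iter r (e, false) →
      G.src d = G.src d' := by
    rintro r e d d' ⟨a, b, h⟩
    obtain ⟨u, v, hp⟩ := f.exists_isPath_iter r (e, false)
    rw [← h, List.append_assoc] at hp
    have := hp.tgt_eq_src
    rwa [RibbonGraph.tgt, Dart.rev_rev] at this
  obtain ⟨r, -, e, h | h⟩ := h
  · exact key h
  · exact (key h).symm

/-- A function on the gates whose values at the two ends of every infinitesimal edge add up to
zero. -/
structure IsTurnAlternating {R : Type*} [CommRing R] (f : GraphMap G) (ψ : Dart E → R) : Prop where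
  eq_of_sameGate : ∀ {d d'}, f.SameGate d d' → ψ d = ψ d'
  add_eq_zero : ∀ {d d'}, f.TakesTurn d d' → ψ d + ψ d' = 0

namespace IsTurnAlternating

variable {R : Type*} [CommRing R] {ψ : Dart E → R}

theorem comp_deriv (hf : f.IsTrainTrackMap) (h : f.IsTurnAlternating ψ) :
    f.IsTurnAlternating (ψ ∘ f.deriv) :=
  ⟨fun hd => h.1 (hd.deriv hf), fun hd => h.2 (hd.deriv hf)⟩

theorem map {S : Type*} [CommRing S] (φ : R →+* S) (h : f.IsTurnAlternating ψ) :
    f.IsTurnAlternating (fun d => φ (ψ d)) :=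
  ⟨fun hd => by rw [h.1 hd], fun hd => by rw [← map_add, h.2 hd, map_zero]⟩

/-- The sum telescopes: the two contributions at each interior turn cancel, leaving the two outer
ends. -/
theorem sum_map_add {p : List (Dart E)} (h : p.IsChain fun d d' => ψ d.rev + ψ d' = 0)
    {x y : Dart E} (hx : p.head? = some x) (hy : p.getLast? = some y) :
    (p.map fun d => ψ d + ψ d.rev).sum = ψ x + ψ y.rev := by
  induction p generalizing x with
  | nil => simp at hx
  | cons d p ih =>
    obtain rfl : d = x := by simpa using hx
    cases p with
    | nil =>
      obtain rfl : d = y := by simpa using hy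
      simp
    | cons d' p =>
      rw [List.isChain_cons_cons] at h
      rw [List.map_cons, List.sum_cons, ih h.2 rfl (by simpa using hy)]
      linear_combination h.1

/-- All turns inside `f(e)` are taken, already with `r = 1`, so the sum along `f(e)` telescopes to
its end darts, which are the derivatives of the two orientations of `e`. -/
theorem pullback_endSum (hf : f.IsTrainTrackMap) (h : f.IsTurnAlternating ψ) :
    f.pullback (endSum ψ) = endSum (ψ ∘ f.deriv) := by
  ext e
  have hlast : (f.edge (e, false)).getLast? = some (f.deriv (e, true)).rev := by
    have h₁ := head?_edge hf (e, true)
    rw [show (e, true) = Dart.rev (e, false) from rfl, f.edge_rev, revPath, List.head?_reverse,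
      List.getLast?_map, Option.map_eq_some_iff] at h₁
    obtain ⟨a, ha, ha'⟩ := h₁
    rw [ha, show (e, true) = Dart.rev (e, false) from rfl, ← ha', Dart.rev_rev]
  have hchain : (f.edge (e, false)).IsChain fun d d' => ψ d.rev + ψ d' = 0 := by
    rw [List.isChain_iff_forall_rel_of_append_cons_cons]
    intro a b p q hpq
    refine h.2 ⟨1, one_pos, e, Or.inl ⟨p, q, ?_⟩⟩
    rw [Dart.rev_rev, iter_succ]
    simp [iter, onPath, hpq]
  have hs := sum_map_add hchain (head?_edge hf (e, false)) hlast
  rw [Dart.rev_rev] at hs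
  refine Eq.trans ?_ hs
  simp only [pullback, pathSum, endSum_fst]

end IsTurnAlternating

/-- Both darts of a turn start at the same vertex, so the values agree and cancel modulo 2. Hence
mod 2 coboundaries also obey `pullback_endSum`. -/
theorem isTurnAlternating_comp_src {R : Type*} [CommRing R] [CharP R 2] (f : GraphMap G)
    (c : V → R) : f.IsTurnAlternating fun d => c (G.src d) :=
  ⟨fun h => by rw [h.1], fun h => by rw [h.src_eq, CharTwo.add_self_eq_zero]⟩

/-- A vertex with at most two gates imposes a condition on weights that is odd exactly at the darts
starting there. -/
theorem AtMostTwoGates.exists_isTurnAlternating [DecidableEq V] (hf : f.IsTrainTrackMap) {v : V}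
    (hv : f.AtMostTwoGates v) : ∃ ψ : Dart E → ℤ, f.IsTurnAlternating ψ ∧
      ∀ d, (ψ d : ZMod 2) = if G.src d = v then 1 else 0 := by
  classical
  by_cases hd : ∃ d₀, G.src d₀ = v
  · obtain ⟨d₀, hd₀⟩ := hd
    have eqv := sameGate_equivalence hf
    -- The gate of `d₀` gets 1 and the other gate at `v`, if any, gets -1. A turn at `v` joins
    -- distinct gates, hence exactly these two; both values are odd.
    refine ⟨fun d => if G.src d = v then (if f.SameGate d d₀ then 1 else -1) else 0,
      ⟨fun {d d'} h => ?_, fun {d d'} h => ?_⟩, fun d => ?_⟩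
    · have h' : f.SameGate d d₀ ↔ f.SameGate d' d₀ := ⟨eqv.trans (eqv.symm h), eqv.trans h⟩
      simp only [h.1, h']
    · have hs := h.src_eq
      have hn := h.not_sameGate hf
      by_cases hdv : G.src d' = v
      · by_cases h₁ : f.SameGate d d₀ <;> by_cases h₂ : f.SameGate d' d₀
        · exact absurd (eqv.trans h₁ (eqv.symm h₂)) hn
        · simp [hs, hdv, h₁, h₂]
        · simp [hs, hdv, h₁, h₂]
        · obtain ⟨i, j, hij, h'⟩ := hv ![d, d', d₀] fun i => by fin_cases i <;> simp [hs, hdv, hd₀]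
          have hn' := fun h => hn (eqv.symm h)
          have h₁' := fun h => h₁ (eqv.symm h)
          have h₂' := fun h => h₂ (eqv.symm h)
          fin_cases i <;> fin_cases j <;> first | exact absurd rfl hij | contradiction
      · simp [hs, hdv]
    · dsimp only
      split_ifs <;> simp
  · push Not at hd
    exact ⟨0, ⟨fun _ => rfl, fun _ => rfl⟩, fun d => by simp [hd]⟩

/-! ### Weights -/

section Weights

theorem isTurnAlternating_comp_gate (hf : f.IsTrainTrackMap) {φ : f.Gate → ℝ}
    (h : ∀ a b, s(a, b) ∈ f.infEdges → φ a + φ b = 0) :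
    f.IsTurnAlternating fun d => φ (f.gate d) :=
  ⟨fun hd => by rw [(gate_eq_iff hf).2 hd],
    fun hd => h _ _ ⟨_, _, rfl, fun h' => hd.not_sameGate hf ((gate_eq_iff hf).1 h'), hd⟩⟩

theorem ne_of_mem_infEdges {a b : f.Gate} (h : s(a, b) ∈ f.infEdges) : a ≠ b := by
  obtain ⟨d, d', h, hne, -⟩ := h
  rcases Sym2.eq_iff.1 h with ⟨rfl, rfl⟩ | ⟨rfl, rfl⟩
  exacts [hne, hne.symm]

open scoped Classical in
theorem sum_mem_infEdge [Fintype f.Gate] {a b : f.Gate} (h : s(a, b) ∈ f.infEdges)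
    (φ : f.Gate → ℝ) : (∑ g, if g ∈ s(a, b) then φ g else 0) = φ a + φ b := by
  rw [← Finset.sum_filter]
  have : Finset.univ.filter (fun g => g ∈ s(a, b)) = {a, b} := by
    ext g
    simp
  rw [this, Finset.sum_pair (ne_of_mem_infEdges h)]

variable [Fintype E]

open scoped Classical in
theorem sum_mul_gate [Fintype f.Gate] (η : E → ℝ) (φ : f.Gate → ℝ) :
    ∑ d : Dart E, η d.1 * φ (f.gate d) =
      ∑ g, (∑ d : Dart E, if f.gate d = g then η d.1 else 0) * φ g := by
  simp only [Finset.sum_mul]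
  rw [Finset.sum_comm]
  simp

open scoped Classical in
theorem sum_infEdges_mul [Fintype f.Gate] (ω : f.infEdges → ℝ) (φ : f.Gate → ℝ) :
    ∑ g, (∑ z : f.infEdges, if g ∈ z.1 then ω z else 0) * φ g =
      ∑ z : f.infEdges, ω z * ∑ g, if g ∈ z.1 then φ g else 0 := by
  simp only [Finset.sum_mul, Finset.mul_sum]
  rw [Finset.sum_comm]
  simp

/-- Add the switch conditions with coefficients `ψ`: an infinitesimal edge enters with the sum of
`ψ` over its two ends, which is zero. -/
theorem dotProduct_eq_zero_of_mem_weightSpace {η : E → ℝ} (hη : η ∈ f.weightSpace)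
    {ψ : Dart E → ℝ} (hψ : f.IsTurnAlternating ψ) : η ⬝ᵥ endSum ψ = 0 := by
  classical
  obtain ⟨ω, hω, rfl⟩ := hη
  have : Finite f.Gate := Quot.finite _
  have := Fintype.ofFinite f.Gate
  let φ : f.Gate → ℝ := Quot.lift ψ fun _ _ h => hψ.1 h
  have hω' : ∀ g, (∑ d : Dart E, if f.gate d = g then ω (Sum.inl d.1) else 0) =
      ∑ z : f.infEdges, if g ∈ z.1 then ω (Sum.inr z) else 0 := fun g => by
    simpa only [SwitchCondition] using hω g
  have h := sum_mul_gate (f := f) (fun e => ω (Sum.inl e)) φ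
  simp only [hω', sum_infEdges_mul] at h
  rw [dotProduct_endSum]
  refine h.trans (Finset.sum_eq_zero fun z _ => ?_)
  obtain ⟨z, d, d', rfl, hne, ht⟩ := z
  rw [sum_mem_infEdge ⟨d, d', rfl, hne, ht⟩]
  exact mul_eq_zero_of_right _ (hψ.2 ht)

theorem mem_weightSpace (hf : f.IsTrainTrackMap) {η : E → ℝ}
    (h : ∀ ψ : Dart E → ℝ, f.IsTurnAlternating ψ → η ⬝ᵥ endSum ψ = 0) : η ∈ f.weightSpace := by
  classical
  have : Finite f.Gate := Quot.finite _
  have := Fintype.ofFinite f.Gate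
  let A : (f.infEdges → ℝ) →ₗ[ℝ] (f.Gate → ℝ) :=
    Matrix.mulVecLin (Matrix.of fun g z => if g ∈ z.1 then 1 else 0)
  have hA : ∀ ω g, A ω g = ∑ z : f.infEdges, if g ∈ z.1 then ω z else 0 := fun ω g => by
    simp [A, Matrix.mulVec, dotProduct]
  let b : f.Gate → ℝ := fun g => ∑ d : Dart E, if f.gate d = g then η d.1 else 0
  -- The vector `b` holds the real weight at each gate, and `A` sums infinitesimal weights. A
  -- functional that kills the range of `A` but not `b` would be an alternating function violating
  -- `h`.
  have hb : b ∈ LinearMap.range A := by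
    by_contra hb
    obtain ⟨ℓ, hℓ, hle⟩ := Submodule.exists_le_ker_of_notMem hb
    let φ : f.Gate → ℝ := fun g => ℓ (Pi.single g 1)
    have hφ : ∀ y : f.Gate → ℝ, ℓ y = ∑ g, y g * φ g := fun y => by
      conv_lhs => rw [pi_eq_sum_univ' y]
      simp [φ, map_sum]
    have hφ' : ∀ a b, s(a, b) ∈ f.infEdges → φ a + φ b = 0 := by
      intro a b hab
      have h₁ : ℓ (A (Pi.single ⟨_, hab⟩ 1)) = 0 := hle ⟨_, rfl⟩
      rw [hφ] at h₁
      simp only [hA, sum_infEdges_mul] at h₁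
      rw [Finset.sum_eq_single ⟨_, hab⟩ (fun z _ hz => by rw [Pi.single_eq_of_ne hz, zero_mul])
        (fun h' => absurd (Finset.mem_univ _) h'), Pi.single_eq_same, one_mul,
        sum_mem_infEdge hab] at h₁
      exact h₁
    refine hℓ ?_
    rw [hφ, ← sum_mul_gate, ← h _ (isTurnAlternating_comp_gate hf hφ'), dotProduct_endSum]
  obtain ⟨ω, hω⟩ := hb
  refine ⟨Sum.elim η ω, fun g => ?_, rfl⟩
  have := congrFun hω g
  rw [hA] at this
  unfold SwitchCondition
  simp only [Sum.elim_inl, Sum.elim_inr]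
  convert this.symm

theorem pushforward_apply (f : GraphMap G) (η : E → ℝ) :
    f.pushforward η = f.transitionMatrixOver ℝ *ᵥ η := by
  classical
  exact Matrix.toLin'_apply _ _

theorem pushforward_mem_weightSpace (hf : f.IsTrainTrackMap) {η : E → ℝ}
    (hη : η ∈ f.weightSpace) : f.pushforward η ∈ f.weightSpace := by
  refine mem_weightSpace hf fun ψ hψ => ?_
  rw [pushforward_apply, transitionMatrixOver_mulVec_dotProduct, hψ.pullback_endSum hf]
  exact dotProduct_eq_zero_of_mem_weightSpace hη (hψ.comp_deriv hf)

/-! ### Injectivity on the weight space -/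

/-- A chain modulo `2` whose boundary is supported on periodic vertices vanishes if its image
does. -/
theorem eq_zero_of_transitionMatrixOver_mulVec_eq_zero [Fintype V] [DecidableEq V]
    (hf : f.IsTrainTrackMap) (he : f.IsHomotopyEquiv) {x : E → ZMod 2}
    (hx : f.transitionMatrixOver (ZMod 2) *ᵥ x = 0)
    (hv : ∀ v ∉ Function.periodicPts f.vert,
      x ⬝ᵥ endSum (fun d => if G.src d = v then 1 else 0) = 0) : x = 0 := by
  have hpull : ∀ ξ, x ⬝ᵥ f.pullback ξ = 0 := fun ξ => by
    rw [← transitionMatrixOver_mulVec_dotProduct, hx, zero_dotProduct]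
  have hbd : ∀ v, x ⬝ᵥ endSum (fun d => if G.src d = v then 1 else 0) = 0 := by
    intro v
    by_cases hper : v ∈ Function.periodicPts f.vert
    -- Pulling back the coboundary of the indicator of `f(v)` gives the sum of the boundary
    -- coefficients of `x` over the fibre through `v`. In that fibre only `v` is periodic, and the
    -- other coefficients vanish by `hv`.
    · let c : V → ZMod 2 := fun w => if w = f.vert v then 1 else 0
      have h₁ := hpull (endSum fun d => c (G.src d))
      rw [(f.isTurnAlternating_comp_src c).pullback_endSum hf] at h₁
      have h₂ : ((fun d => c (G.src d)) ∘ f.deriv) = fun d => (c ∘ f.vert) (G.src d) := by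
        ext d
        simp only [Function.comp_apply, src_deriv hf]
      rw [h₂, endSum_comp_dotProduct, Finset.sum_eq_single v] at h₁
      · simpa [c] using h₁
      · intro w _ hw
        by_cases hper' : w ∈ Function.periodicPts f.vert
        · have : f.vert w ≠ f.vert v := fun h =>
            hw ((Function.bijOn_periodicPts f.vert).injOn hper' hper h)
          simp [c, this]
        · rw [hv w hper', mul_zero]
      · exact fun h => absurd (Finset.mem_univ v) h
    · exact hv v hper
  obtain ⟨h, hh, -⟩ := he
  -- Now `x` is a cycle, so it pairs to zero with coboundaries. Every `ξ` is a pullback under `f` up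
  -- to a coboundary, and `x` annihilates pullbacks.
  refine dotProduct_eq_zero x fun ξ => ?_
  obtain ⟨c, hc⟩ := pullback_of_homotopicToId hh ξ
  have h₁ := hpull (h.pullback ξ)
  rw [hc, dotProduct_add, endSum_comp_dotProduct] at h₁
  simpa only [hbd, mul_zero, Finset.sum_const_zero, add_zero] using h₁

theorem eq_zero_of_pushforward_eq_zero [Fintype V] (hf : f.IsTrainTrackMap)
    (hi : f.InducedByHomeo) {η : E → ℝ} (hη : η ∈ f.weightSpace) (h : f.pushforward η = 0) :
    η = 0 := by
  classical
  have hψ : ∀ v, ∃ ψ : Dart E → ℤ, f.IsTurnAlternating ψ ∧ (v ∉ Function.periodicPts f.vert →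
      ∀ d, (ψ d : ZMod 2) = if G.src d = v then 1 else 0) := by
    intro v
    by_cases hv : v ∈ Function.periodicPts f.vert
    -- Periodic vertices receive the zero row, which imposes no condition.
    · exact ⟨0, ⟨fun _ => rfl, fun _ => rfl⟩, fun h => absurd hv h⟩
    · obtain ⟨ψ, hψ, h'⟩ :=
        (atMostTwoGates_of_notMem_periodicPts hf hi.1 hv).exists_isTurnAlternating hf
      exact ⟨ψ, hψ, fun _ => h'⟩
  choose ψ hψ hψ' using hψ
  let M : Matrix (E ⊕ V) E ℤ :=
    Matrix.fromRows (f.transitionMatrixOver ℤ) (.of fun v => endSum (ψ v))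
  have hM : ∀ (R : Type) [CommRing R] (x : E → R), M.map (Int.castRingHom R) *ᵥ x = 0 ↔
      f.transitionMatrixOver R *ᵥ x = 0 ∧ ∀ v, x ⬝ᵥ endSum (fun d => (ψ v d : R)) = 0 := by
    intro R _ x
    have hrow : (Matrix.of fun v => endSum (ψ v)).map (Int.castRingHom R) =
        .of fun v => endSum fun d => (ψ v d : R) := by
      ext v e
      simp [endSum]
    simp only [M]
    rw [Matrix.fromRows_map, Matrix.fromRows_mulVec, transitionMatrixOver_map, hrow]
    simp [funext_iff, Matrix.mulVec, dotProduct_comm x]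
  refine Matrix.mulVec_eq_zero_of_injective_zmod_two M (fun x hx => ?_) ((hM ℝ η).2 ⟨?_, ?_⟩)
  · obtain ⟨h₁, h₂⟩ := (hM _ x).1 hx
    refine eq_zero_of_transitionMatrixOver_mulVec_eq_zero hf hi.2 h₁ fun v hv => ?_
    refine Eq.trans ?_ (h₂ v)
    simp only [hψ' v hv]
  · rw [← pushforward_apply, h]
  · exact fun v => dotProduct_eq_zero_of_mem_weightSpace hη ((hψ v).map (Int.castRingHom ℝ))

end Weights

end GraphMap

theorem mainTheorem5 {V E : Type*} [Fintype V] [Fintype E] (G : RibbonGraph V E)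
    (f : GraphMap G) (hf : f.IsBestvinaHandel) :
    ∃ Φ : f.weightSpace ≃ₗ[ℝ] f.weightSpace,
      ∀ η : f.weightSpace, (Φ η : E → ℝ) = f.pushforward (η : E → ℝ) := by
  let T : f.weightSpace →ₗ[ℝ] f.weightSpace :=
    f.pushforward.restrict fun _ => GraphMap.pushforward_mem_weightSpace hf.isTrainTrackMap
  have hT : Function.Injective T := by
    rw [injective_iff_map_eq_zero]
    intro η h
    exact Subtype.ext (GraphMap.eq_zero_of_pushforward_eq_zero hf.isTrainTrackMap
      hf.inducedByHomeo η.2 (congrArg Subtype.val h))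
  exact ⟨LinearEquiv.ofInjectiveEndo T hT, fun η => rfl⟩
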